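/- Let $d\in\mathbb{N}_0$. A probability measure on $\mathbb{R}^d$ is infinitely divisible if for every $n\ge 1$ it is the $n$-fold convolution of some probability measure with itself. A probability measure $\mu$ on $\mathbb{R}^d$ is called quasi-infinitely divisible if its characteristic function $\widehat\mu(z)=\int_{\mathbb{R}^d} e^{\mathrm{i}\langle z,x\rangle}\,\mu(\mathrm{d}x)$ satisfies $\widehat\mu(z)=\widehat\mu_1(z)/\widehat\mu_2(z)$ for all $z\in\mathbb{R}^d$ with infinitely divisible distributions $\mu_1,\mu_2$ on $\mathbb{R}^d$. For $r>0$ let $\mathcal{B}_r^d$ be the family of Borel sets $B\subset\{x\in\mathbb{R}^d:|x|\ge r\}$, and let $\mathcal{B}_0^d=\bigcup_{r>0}\mathcal{B}_r^d$. Let $\nu:\mathcal{B}_0^d\to\mathbb{R}$ be a function whose restriction to $\mathcal{B}_r^d$ is a finite signed measure for every $r>0$. Its positive part $\nu^+$, negative part $\nu^-$ and total variation $|\nu|$ are the unique Borel measures on $\mathbb{R}^d$ that give no mass to $\{0\}$ and agree on each $\mathcal{B}_r^d$ with the positive part, negative part and total variation of $\nu_{|\mathcal{B}_r^d}$. The function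 $\nu$ is called a quasi-Lévy type measure if $\int_{\mathbb{R}^d}(1\wedge|x|^2)\,|\nu|(\mathrm{d}x)<\infty$. For $f:\mathbb{R}^d\to\mathbb{C}$ integrable with respect to $|\nu|$, put $\int f\,\mathrm{d}\nu=\int f\,\mathrm{d}\nu^+-\int f\,\mathrm{d}\nu^-$. A probability measure $\mu$ has characteristic triplet $(A,\nu,\gamma)$ if $A\in\mathbb{R}^{d\times d}$ is symmetric, $\nu$ is a quasi-Lévy type measure on $\mathbb{R}^d$, $\gamma\in\mathbb{R}^d$, and for all $z\in\mathbb{R}^d$ $$\widehat\mu(z)=\exp\left(\mathrm{i}\langle\gamma,z\rangle-\frac12\langle z,Az\rangle+\int_{\mathbb{R}^d}\left(e^{\mathrm{i}\langle z,x\rangle}-1-\mathrm{i}\langle z,x\rangle\mathbf{1}_{[0,1]}(|x|)\right)\nu(\mathrm{d}x)\right).$$ **Lemma.** If $\mu$ is a quasi-infinitely divisible distribution on $\mathbb{R}^d$ with characteristic triplet $(A,\nu,\gamma)$, then $A$ is non-negative definite, i.e. $A$ is symmetric and $\langle z,Az\rangle\ge 0$ for all $z\in\mathbb{R}^d$. 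-/

import Mathlib

open MeasureTheory
open scoped ENNReal

namespace QID

/-- Euclidean space `ℝ^d` (with the Euclidean norm and the Borel `σ`-algebra). -/
abbrev E (d : ℕ) : Type := EuclideanSpace ℝ (Fin d)

/-! ### Infinitely divisible and quasi-infinitely divisible distributions -/

/-- The `n`-fold convolution `μ ∗ ⋯ ∗ μ` of a measure with itself. -/
noncomputable def convPow {d : ℕ} (μ : Measure (E d)) : ℕ → Measure (E d)
  | 0 => Measure.dirac 0
  | n + 1 => Measure.conv (convPow μ n) μ

/-- A probability distribution is infinitely divisible if, for every `n ≥ 1`, it is the `n`-fold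
convolution of some probability distribution with itself. -/
def IsInfinitelyDivisible {d : ℕ} (μ : Measure (E d)) : Prop :=
  IsProbabilityMeasure μ ∧
    ∀ n : ℕ, 1 ≤ n → ∃ ρ : Measure (E d), IsProbabilityMeasure ρ ∧ convPow ρ n = μ

/-- A probability distribution is quasi-infinitely divisible if its characteristic function is the
quotient of the characteristic functions of two infinitely divisible distributions. (The
characteristic function of an infinitely divisible distribution has no zeros.) -/
def IsQuasiInfinitelyDivisible {d : ℕ} (μ : Measure (E d)) : Prop :=
  IsProbabilityMeasure μ ∧
    ∃ μ₁ μ₂ : Measure (E d), IsInfinitelyDivisible μ₁ ∧ IsInfinitelyDivisible μ₂ ∧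
      ∀ z : E d, charFun μ z = charFun μ₁ z / charFun μ₂ z

/-! ### Quasi-Lévy type measures -/

/-- The closed exterior `{x : |x| ≥ r}` of a ball. -/
def away (d : ℕ) (r : ℝ) : Set (E d) := {x | r ≤ ‖x‖}

/-- `𝓑_r^d`: the Borel sets contained in `{x : |x| ≥ r}`. -/
def borelAway (d : ℕ) (r : ℝ) : Set (Set (E d)) := {B | MeasurableSet B ∧ B ⊆ away d r}

/-- `𝓑_0^d = ⋃_{r > 0} 𝓑_r^d`: the Borel sets that are bounded away from `0`. -/
def borelAwayZero (d : ℕ) : Set (Set (E d)) := ⋃ (r : ℝ) (_ : 0 < r), borelAway d r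

lemma measurableSet_away (d : ℕ) (r : ℝ) : MeasurableSet (away d r) :=
  measurableSet_le measurable_const measurable_norm

lemma mem_borelAwayZero {d : ℕ} {r : ℝ} (hr : 0 < r) {B : Set (E d)} (hB : B ∈ borelAway d r) :
    B ∈ borelAwayZero d :=
  Set.mem_iUnion₂.2 ⟨r, hr, hB⟩

lemma empty_mem (d : ℕ) : (∅ : Set (E d)) ∈ borelAwayZero d :=
  mem_borelAwayZero one_pos ⟨MeasurableSet.empty, Set.empty_subset _⟩

lemma inter_away_mem {d : ℕ} {B : Set (E d)} (hB : MeasurableSet B) (r : ℝ) :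
    B ∩ away d r ∈ borelAway d r :=
  ⟨hB.inter (measurableSet_away d r), Set.inter_subset_right⟩

lemma iUnion_mem {d : ℕ} {r : ℝ} {f : ℕ → Set (E d)} (hf : ∀ i, f i ∈ borelAway d r) :
    (⋃ i, f i) ∈ borelAway d r :=
  ⟨MeasurableSet.iUnion fun i => (hf i).1, Set.iUnion_subset fun i => (hf i).2⟩

/-- A function `ν : 𝓑_0^d → ℝ` whose restriction to `𝓑_r^d` is a finite signed measure, for every
`r > 0`. -/
structure LocalSignedMeasure (d : ℕ) where
  /-- the underlying set function on `𝓑_0^d` -/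
  toFun : borelAwayZero d → ℝ
  /-- the empty set has measure zero -/
  map_empty : toFun ⟨∅, empty_mem d⟩ = 0
  /-- `σ`-additivity on each `𝓑_r^d` -/
  hasSum_iUnion : ∀ (r : ℝ) (hr : 0 < r) (f : ℕ → Set (E d)) (hf : ∀ i, f i ∈ borelAway d r),
    Pairwise (Function.onFun Disjoint f) →
      HasSum (fun i => toFun ⟨f i, mem_borelAwayZero hr (hf i)⟩)
        (toFun ⟨⋃ i, f i, mem_borelAwayZero hr (iUnion_mem hf)⟩)

namespace LocalSignedMeasure

open scoped Classical in
/-- The restriction of `ν` to `𝓑_r^d`, extended by zero to a finite signed measure on `ℝ^d`: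
`B ↦ ν (B ∩ {x : |x| ≥ r})`. -/
noncomputable def restr {d : ℕ} (ν : LocalSignedMeasure d) (r : ℝ) (hr : 0 < r) :
    SignedMeasure (E d) where
  measureOf' B :=
    if hB : MeasurableSet B then
      ν.toFun ⟨B ∩ away d r, mem_borelAwayZero hr (inter_away_mem hB r)⟩ else 0
  empty' := by
    simp only [MeasurableSet.empty, dite_true, Set.empty_inter]
    exact ν.map_empty
  not_measurable' B hB := by simp [hB]
  m_iUnion' f hf hd := by
    have h := ν.hasSum_iUnion r hr (fun i => f i ∩ away d r) (fun i => inter_away_mem (hf i) r)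
      (fun i j hij => (hd hij).mono Set.inter_subset_left Set.inter_subset_left)
    simpa only [hf, MeasurableSet.iUnion hf, dite_true, Set.iUnion_inter] using h

/-- The sets `{|x| ≥ 1}` and `{1/(n+1) ≤ |x| < 1/n}`, `n ≥ 1`, which partition `ℝ^d ∖ {0}`. -/
def shell (d n : ℕ) : Set (E d) := disjointed (fun n : ℕ => away d (1 / ((n : ℝ) + 1))) n

/-- The positive part `ν⁺`: the measure on `ℝ^d` with no mass at `0` whose restriction to each
`𝓑_r^d` is the positive part in the Jordan decomposition of the restriction of `ν`;
see `posPart_zero` and `posPart_apply`. -/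
noncomputable def posPart {d : ℕ} (ν : LocalSignedMeasure d) : Measure (E d) :=
  Measure.sum fun n : ℕ => ((ν.restr (1 / ((n : ℝ) + 1))
    Nat.one_div_pos_of_nat).toJordanDecomposition.posPart).restrict (shell d n)

/-- The negative part `ν⁻`: the measure on `ℝ^d` with no mass at `0` whose restriction to each
`𝓑_r^d` is the negative part in the Jordan decomposition of the restriction of `ν`;
see `negPart_zero` and `negPart_apply`. -/
noncomputable def negPart {d : ℕ} (ν : LocalSignedMeasure d) : Measure (E d) :=
  Measure.sum fun n : ℕ => ((ν.restr (1 / ((n : ℝ) + 1))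
    Nat.one_div_pos_of_nat).toJordanDecomposition.negPart).restrict (shell d n)

/-- The total variation `|ν| = ν⁺ + ν⁻`; see `totalVariation_zero` and `totalVariation_apply`. -/
noncomputable def totalVariation {d : ℕ} (ν : LocalSignedMeasure d) : Measure (E d) :=
  ν.posPart + ν.negPart

lemma measurableSet_shell (d n : ℕ) : MeasurableSet (shell d n) :=
  MeasurableSet.disjointed (fun _ => measurableSet_away d _) n

lemma shell_subset (d n : ℕ) : shell d n ⊆ away d (1 / ((n : ℝ) + 1)) :=
  disjointed_subset _ n

lemma mem_iUnion_shell {d : ℕ} {x : E d} : x ∈ ⋃ n, shell d n ↔ x ≠ 0 := by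
  unfold shell
  rw [iUnion_disjointed, Set.mem_iUnion]
  constructor
  · rintro ⟨n, hn⟩ rfl
    have : (0 : ℝ) < 1 / ((n : ℝ) + 1) := Nat.one_div_pos_of_nat
    simp only [away, Set.mem_ofPred_eq, norm_zero] at hn
    linarith
  · intro hx
    obtain ⟨n, hn⟩ := exists_nat_one_div_lt (norm_pos_iff.2 hx)
    exact ⟨n, hn.le⟩

/-- The Jordan decomposition is compatible with restriction to a measurable set. -/
lemma jordan_restrict {d : ℕ} (s : SignedMeasure (E d)) {K : Set (E d)} (hK : MeasurableSet K) :
    (SignedMeasure.toJordanDecomposition (s.restrict K)).posPart = s.toJordanDecomposition.posPart.restrict K ∧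
    (SignedMeasure.toJordanDecomposition (s.restrict K)).negPart = s.toJordanDecomposition.negPart.restrict K := by
  let j : JordanDecomposition (E d) :=
    { posPart := s.toJordanDecomposition.posPart.restrict K
      negPart := s.toJordanDecomposition.negPart.restrict K
      mutuallySingular :=
        s.toJordanDecomposition.mutuallySingular.mono Measure.restrict_le_self
          Measure.restrict_le_self }
  have h : (SignedMeasure.toJordanDecomposition (s.restrict K)) = j := by
    apply SignedMeasure.toJordanDecomposition_eq
    conv_lhs => rw [← s.toSignedMeasure_toJordanDecomposition]
    rw [JordanDecomposition.toSignedMeasure, JordanDecomposition.toSignedMeasure,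
      VectorMeasure.restrict_sub, Measure.toSignedMeasure_restrict_eq_restrict_toSignedMeasure _ _ hK,
      Measure.toSignedMeasure_restrict_eq_restrict_toSignedMeasure _ _ hK]
  rw [h]
  exact ⟨rfl, rfl⟩

lemma restr_apply_inter {d : ℕ} (ν : LocalSignedMeasure d) {r : ℝ} (hr : 0 < r) {B : Set (E d)}
    (hB : MeasurableSet B) : ν.restr r hr B =
      ν.toFun ⟨B ∩ away d r, mem_borelAwayZero hr (inter_away_mem hB r)⟩ :=
  dif_pos hB

lemma restr_restrict {d : ℕ} (ν : LocalSignedMeasure d) {r r' : ℝ} (hr : 0 < r) (hr' : 0 < r')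
    {K : Set (E d)} (hK : MeasurableSet K) (h : K ⊆ away d r) (h' : K ⊆ away d r') :
    (ν.restr r hr).restrict K = (ν.restr r' hr').restrict K := by
  ext B hB
  rw [VectorMeasure.restrict_apply _ hK hB, VectorMeasure.restrict_apply _ hK hB]
  have e : ∀ r, K ⊆ away d r → B ∩ K ∩ away d r = B ∩ K := fun r h =>
    Set.inter_eq_left.2 (Set.inter_subset_right.trans h)
  rw [restr_apply_inter ν hr (hB.inter hK), restr_apply_inter ν hr' (hB.inter hK)]
  simp only [e r h, e r' h']

/-- The restriction of `ν` to `𝓑_r^d`, as a signed measure, takes the values of `ν`. -/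
lemma restr_apply {d : ℕ} (ν : LocalSignedMeasure d) {r : ℝ} (hr : 0 < r) {B : Set (E d)}
    (hB : B ∈ borelAway d r) : ν.restr r hr B = ν.toFun ⟨B, mem_borelAwayZero hr hB⟩ := by
  rw [restr_apply_inter ν hr hB.1]
  simp only [Set.inter_eq_left.2 hB.2]

lemma sum_shell_apply {d : ℕ} (m : ℕ → Measure (E d)) (m' : Measure (E d)) {r : ℝ} (hr : 0 < r)
    (h : ∀ n : ℕ, ∀ K, MeasurableSet K → K ⊆ away d (1 / ((n : ℝ) + 1)) → K ⊆ away d r →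
      (m n).restrict K = m'.restrict K)
    {B : Set (E d)} (hB : B ∈ borelAway d r) :
    Measure.sum (fun n => (m n).restrict (shell d n)) B = m' B := by
  have hK : ∀ n, MeasurableSet (B ∩ shell d n) := fun n => hB.1.inter (measurableSet_shell d n)
  have hU : B = ⋃ n, B ∩ shell d n := by
    rw [← Set.inter_iUnion, eq_comm, Set.inter_eq_left]
    intro x hx
    refine mem_iUnion_shell.2 ?_
    rintro rfl
    have := hB.2 hx
    simp only [away, Set.mem_ofPred_eq, norm_zero] at this
    linarith
  rw [Measure.sum_apply _ hB.1]
  conv_rhs => rw [hU]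
  have hd : Pairwise (Function.onFun Disjoint fun n => B ∩ shell d n) := fun i j hij =>
    ((disjoint_disjointed _) hij).mono Set.inter_subset_right Set.inter_subset_right
  rw [measure_iUnion hd hK]
  congr 1
  ext n
  rw [Measure.restrict_apply hB.1]
  have := congrArg (fun μ : Measure (E d) => μ (B ∩ shell d n)) (h n _ (hK n)
    (Set.inter_subset_right.trans (shell_subset d n)) (Set.inter_subset_left.trans hB.2))
  simpa only [Measure.restrict_apply_self] using this

lemma sum_shell_zero {d : ℕ} (m : ℕ → Measure (E d)) :
    Measure.sum (fun n => (m n).restrict (shell d n)) {0} = 0 := by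
  rw [Measure.sum_apply _ (measurableSet_singleton 0), ENNReal.tsum_eq_zero]
  intro n
  rw [Measure.restrict_apply (measurableSet_singleton 0)]
  have : ({0} : Set (E d)) ∩ shell d n = ∅ := by
    ext x
    simp only [Set.mem_inter_iff, Set.mem_singleton_iff, Set.mem_empty_iff_false, iff_false,
      not_and]
    intro hx hn
    exact mem_iUnion_shell.1 (Set.mem_iUnion.2 ⟨n, hn⟩) hx
  rw [this, measure_empty]

lemma posPart_zero {d : ℕ} (ν : LocalSignedMeasure d) : ν.posPart {0} = 0 := sum_shell_zero _

lemma negPart_zero {d : ℕ} (ν : LocalSignedMeasure d) : ν.negPart {0} = 0 := sum_shell_zero _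

lemma totalVariation_zero {d : ℕ} (ν : LocalSignedMeasure d) : ν.totalVariation {0} = 0 := by
  simp [totalVariation, posPart_zero, negPart_zero]

lemma posPart_apply {d : ℕ} (ν : LocalSignedMeasure d) {r : ℝ} (hr : 0 < r) {B : Set (E d)}
    (hB : B ∈ borelAway d r) :
    ν.posPart B = (ν.restr r hr).toJordanDecomposition.posPart B := by
  refine sum_shell_apply _ _ hr (fun n K hK h h' => ?_) hB
  rw [← (jordan_restrict _ hK).1, ← (jordan_restrict _ hK).1, restr_restrict ν _ hr hK h h']

lemma negPart_apply {d : ℕ} (ν : LocalSignedMeasure d) {r : ℝ} (hr : 0 < r) {B : Set (E d)}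
    (hB : B ∈ borelAway d r) :
    ν.negPart B = (ν.restr r hr).toJordanDecomposition.negPart B := by
  refine sum_shell_apply _ _ hr (fun n K hK h h' => ?_) hB
  rw [← (jordan_restrict _ hK).2, ← (jordan_restrict _ hK).2, restr_restrict ν _ hr hK h h']

lemma totalVariation_apply {d : ℕ} (ν : LocalSignedMeasure d) {r : ℝ} (hr : 0 < r)
    {B : Set (E d)} (hB : B ∈ borelAway d r) :
    ν.totalVariation B = (ν.restr r hr).totalVariation B := by
  simp only [totalVariation, SignedMeasure.totalVariation, Measure.add_apply,
    posPart_apply ν hr hB, negPart_apply ν hr hB]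

/-- `ν` is a quasi-Lévy type measure if `x ↦ 1 ∧ |x|²` is integrable with respect to `|ν|`. -/
def IsQuasiLevyType {d : ℕ} (ν : LocalSignedMeasure d) : Prop :=
  Integrable (fun x : E d => min 1 (‖x‖ ^ 2)) ν.totalVariation

/-- The integral with respect to `ν` of a function `f` that is integrable with respect to `|ν|`:
`∫ f dν = ∫ f dν⁺ - ∫ f dν⁻`. -/
noncomputable def integral {d : ℕ} (ν : LocalSignedMeasure d) (f : E d → ℂ) : ℂ :=
  (∫ x, f x ∂ν.posPart) - ∫ x, f x ∂ν.negPart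

end LocalSignedMeasure

/-! ### The Lévy–Khintchine type representation -/

/-- The standard representation function `x ↦ x 𝟙_{[0,1]}(|x|)`. -/
noncomputable def stdRep {d : ℕ} (x : E d) : E d := if ‖x‖ ≤ 1 then x else 0

/-- The Lévy–Khintchine exponent of the triplet `(A, ν, γ)`:
`i⟨γ, z⟩ - ⟨z, A z⟩ / 2 + ∫ (exp (i⟨z, x⟩) - 1 - i⟨z, x⟩ 𝟙_{[0,1]}(|x|)) ν(dx)`.
The integrand is integrable with respect to every quasi-Lévy type measure. -/
noncomputable def levyKhintchineExponent {d : ℕ} (A : Matrix (Fin d) (Fin d) ℝ)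
    (ν : LocalSignedMeasure d) (γ : E d) (z : E d) : ℂ :=
  Complex.I * (inner ℝ γ z : ℝ)
    - (1 / 2 : ℂ) * ((z.ofLp ⬝ᵥ A.mulVec z.ofLp : ℝ) : ℂ)
    + ν.integral fun x =>
        Complex.exp (Complex.I * (inner ℝ z x : ℝ)) - 1 - Complex.I * (inner ℝ z (stdRep x) : ℝ)

/-- `(A, ν, γ)` is the (standard) characteristic triplet of `μ`: `A` is a real symmetric matrix, `ν`
a quasi-Lévy type measure, `γ` a vector, and the characteristic function of `μ` is the exponential
of the Lévy–Khintchine exponent of the triplet. -/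
structure HasCharacteristicTriplet {d : ℕ} (μ : Measure (E d)) (A : Matrix (Fin d) (Fin d) ℝ)
    (ν : LocalSignedMeasure d) (γ : E d) : Prop where
  isSymm : A.IsSymm
  isQuasiLevyType : ν.IsQuasiLevyType
  charFun_eq : ∀ z : E d, charFun μ z = Complex.exp (levyKhintchineExponent A ν γ z)

end QID

namespace QID

open Filter Topology

/-! The Gaussian part dominates the exponent at infinity, and a characteristic function is bounded
by one. Write `ψ` for the Lévy–Khintchine exponent. Since `|exp (ψ z)| ≤ 1`, the real part of `ψ` is
nowhere positive. Along a ray, `t⁻² ψ(t z)` tends to `-⟨z, A z⟩ / 2` as `t → ∞`: the quadratic term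
is unchanged by the scaling, the drift decays like `t⁻¹`, and the integral is `o(t²)`. Taking real
parts in the limit gives `⟨z, A z⟩ ≥ 0`. The signs of `ν` do not matter: the `o(t²)` estimate is
applied to `ν⁺` and `ν⁻` separately. It is dominated convergence, with `norm_levyIntegrand_le` as
the bound and `tendsto_levyIntegrand_div_sq` as the pointwise limit. -/

lemma norm_exp_I_mul_sub_one_sub_le (u : ℝ) :
    ‖Complex.exp (Complex.I * u) - 1 - Complex.I * u‖ ≤ 3 * u ^ 2 := by
  have hI : ‖Complex.I * (u : ℂ)‖ = |u| := by simp
  -- Taylor's estimate gives `u²` when `|u| ≤ 1`; otherwise the triangle inequality gives `2|u| ≤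
  -- 2u²`. The constant 3 is not sharp.
  rcases le_total |u| 1 with h | h
  · have := Complex.norm_exp_sub_one_sub_id_le (x := Complex.I * u) (hI.trans_le h)
    rw [hI, sq_abs] at this
    nlinarith [sq_nonneg u]
  · have h1 : ‖Complex.exp (Complex.I * u) - 1‖ ≤ |u| := Real.norm_exp_I_mul_ofReal_sub_one_le
    have h2 := norm_sub_le (Complex.exp (Complex.I * u) - 1) (Complex.I * u)
    rw [hI] at h2
    nlinarith [sq_abs u]

lemma norm_exp_I_mul_sub_one_le_two (u : ℝ) : ‖Complex.exp (Complex.I * u) - 1‖ ≤ 2 := by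
  have h := norm_sub_le (Complex.exp (Complex.I * u)) 1
  rw [Complex.norm_exp_I_mul_ofReal, norm_one] at h
  linarith

/-- The Lévy–Khintchine integrand at `z`. -/
noncomputable def levyIntegrand {d : ℕ} (z x : E d) : ℂ :=
  Complex.exp (Complex.I * (inner ℝ z x : ℝ)) - 1 - Complex.I * (inner ℝ z (stdRep x) : ℝ)

lemma measurable_stdRep {d : ℕ} : Measurable (stdRep (d := d)) :=
  Measurable.ite (measurableSet_le measurable_norm measurable_const) measurable_id
    measurable_const

lemma measurable_levyIntegrand {d : ℕ} (z : E d) : Measurable (levyIntegrand z) := by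
  have h1 : Measurable fun x : E d => (inner ℝ z x : ℝ) := by fun_prop
  have h2 : Measurable fun x : E d => (inner ℝ z (stdRep x) : ℝ) := h1.comp measurable_stdRep
  unfold levyIntegrand
  fun_prop

/-- In the unit ball the compensator makes the integrand second order, and Cauchy–Schwarz bounds it
by `3‖z‖²‖x‖²`; outside, the compensator vanishes and 2 suffices. The growth in `z` is only
quadratic, so division by `t²` leaves a bound uniform in `t ≥ 1`. -/
lemma norm_levyIntegrand_le {d : ℕ} (z x : E d) :
    ‖levyIntegrand z x‖ ≤ (3 * ‖z‖ ^ 2 + 2) * min 1 (‖x‖ ^ 2) := by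
  unfold levyIntegrand stdRep
  split_ifs with h
  · have h1 := norm_exp_I_mul_sub_one_sub_le (inner ℝ z x)
    have h2 : (inner ℝ z x : ℝ) ^ 2 ≤ (‖z‖ * ‖x‖) ^ 2 :=
      sq_le_sq' (neg_le_of_abs_le (abs_real_inner_le_norm z x)) (real_inner_le_norm z x)
    rw [min_eq_right (by nlinarith [norm_nonneg x])]
    nlinarith [sq_nonneg ‖x‖]
  · have h1 := norm_exp_I_mul_sub_one_le_two (inner ℝ z x)
    rw [min_eq_left (by nlinarith)]
    simp only [inner_zero_right, Complex.ofReal_zero, mul_zero, sub_zero, mul_one]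
    nlinarith [sq_nonneg ‖z‖]

/-- For fixed `x` the exponential part stays bounded by 2 and the compensator grows linearly in `t`,
so both are negligible against `t²`. -/
lemma tendsto_levyIntegrand_div_sq {d : ℕ} (z x : E d) :
    Tendsto (fun t : ℝ => ((t : ℂ) ^ 2)⁻¹ * levyIntegrand (t • z) x) atTop (𝓝 0) := by
  have hlim : Tendsto (fun t : ℝ => 2 * (t ^ 2)⁻¹ + |inner ℝ z (stdRep x)| * t⁻¹) atTop (𝓝 0) := by
    have h1 := (tendsto_inv_atTop_zero.comp
      (tendsto_pow_atTop (α := ℝ) two_ne_zero)).const_mul (2 : ℝ)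
    have h2 := (tendsto_inv_atTop_zero (𝕜 := ℝ)).const_mul |inner ℝ z (stdRep x)|
    simpa using h1.add h2
  refine squeeze_zero_norm' ?_ hlim
  filter_upwards [eventually_gt_atTop 0] with t ht
  have h := norm_sub_le (Complex.exp (Complex.I * (inner ℝ (t • z) x : ℝ)) - 1)
    (Complex.I * (inner ℝ (t • z) (stdRep x) : ℝ))
  have h1 := norm_exp_I_mul_sub_one_le_two (inner ℝ (t • z) x)
  have h2 : ‖Complex.I * ((inner ℝ (t • z) (stdRep x) : ℝ) : ℂ)‖
      = t * |inner ℝ z (stdRep x)| := by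
    rw [norm_mul, Complex.norm_I, one_mul, Complex.norm_real, real_inner_smul_left,
      Real.norm_eq_abs, abs_mul, abs_of_pos ht]
  rw [norm_mul, norm_inv, norm_pow, Complex.norm_real, Real.norm_of_nonneg ht.le]
  calc (t ^ 2)⁻¹ * ‖levyIntegrand (t • z) x‖
      ≤ (t ^ 2)⁻¹ * (2 + t * |inner ℝ z (stdRep x)|) := by
        gcongr
        unfold levyIntegrand
        linarith
    _ = _ := by field_simp

/-- By dominated convergence, the Lévy–Khintchine integral is `o(t ^ 2)` along each ray. -/
lemma tendsto_integral_levyIntegrand_div_sq {d : ℕ} (m : Measure (E d))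
    (hm : Integrable (fun x : E d => min 1 (‖x‖ ^ 2)) m) (z : E d) :
    Tendsto (fun t : ℝ => ((t : ℂ) ^ 2)⁻¹ * ∫ x, levyIntegrand (t • z) x ∂m) atTop (𝓝 0) := by
  have h := tendsto_integral_filter_of_dominated_convergence (μ := m) (l := atTop)
    (F := fun (t : ℝ) x => ((t : ℂ) ^ 2)⁻¹ * levyIntegrand (t • z) x) (f := fun _ => 0)
    (fun x => (3 * ‖z‖ ^ 2 + 2) * min 1 (‖x‖ ^ 2))
    (.of_forall fun t => ((measurable_levyIntegrand _).const_mul _).aestronglyMeasurable)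
    ?_ (hm.const_mul _) (.of_forall (tendsto_levyIntegrand_div_sq z))
  · simpa only [integral_const_mul, integral_zero] using h
  filter_upwards [eventually_ge_atTop 1] with t ht
  refine .of_forall fun x => ?_
  have ht0 : 0 < t := one_pos.trans_le ht
  rw [norm_mul, norm_inv, norm_pow, Complex.norm_real, Real.norm_of_nonneg ht0.le,
    inv_mul_le_iff₀ (by positivity)]
  refine (norm_levyIntegrand_le _ _).trans ?_
  rw [norm_smul, Real.norm_of_nonneg ht0.le, ← mul_assoc]
  gcongr
  -- What remains amounts to `2 ≤ 2t²`, which is where `t ≥ 1` enters.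
  nlinarith

/-- Along each ray the Lévy–Khintchine exponent is asymptotically given by its Gaussian part. -/
lemma tendsto_levyKhintchineExponent_div_sq {d : ℕ} (A : Matrix (Fin d) (Fin d) ℝ)
    (ν : LocalSignedMeasure d) (hν : ν.IsQuasiLevyType) (γ z : E d) :
    Tendsto (fun t : ℝ => ((t : ℂ) ^ 2)⁻¹ * levyKhintchineExponent A ν γ (t • z)) atTop
      (𝓝 (-(1 / 2 : ℂ) * ((z.ofLp ⬝ᵥ A.mulVec z.ofLp : ℝ) : ℂ))) := by
  -- `ν⁺` and `ν⁻` are both at most `|ν|`, so each inherits integrability of `1 ∧ |x|²`.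
  have hpos := tendsto_integral_levyIntegrand_div_sq ν.posPart
    (hν.mono_measure (Measure.le_add_right le_rfl)) z
  have hneg := tendsto_integral_levyIntegrand_div_sq ν.negPart
    (hν.mono_measure (Measure.le_add_left le_rfl)) z
  have hdrift : Tendsto (fun t : ℝ => Complex.I * (inner ℝ γ z : ℝ) * ((t⁻¹ : ℝ) : ℂ)) atTop
      (𝓝 0) := by
    simpa using ((Complex.continuous_ofReal.tendsto 0).comp
      (tendsto_inv_atTop_zero (𝕜 := ℝ))).const_mul (Complex.I * (inner ℝ γ z : ℝ))
  have h := (hdrift.add (tendsto_const_nhds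
    (x := -(1 / 2 : ℂ) * ((z.ofLp ⬝ᵥ A.mulVec z.ofLp : ℝ) : ℂ)))).add (hpos.sub hneg)
  rw [zero_add, sub_zero, add_zero] at h
  -- For `t > 0` the three limits add up to the scaled exponent exactly, by homogeneity of degree
  -- one in the drift and two in the Gaussian term.
  refine h.congr' ?_
  filter_upwards [eventually_gt_atTop 0] with t ht
  have ht0 : (t : ℂ) ≠ 0 := Complex.ofReal_ne_zero.2 ht.ne'
  have hI : (ν.integral fun x => Complex.exp (Complex.I * (inner ℝ (t • z) x : ℝ)) - 1
      - Complex.I * (inner ℝ (t • z) (stdRep x) : ℝ))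
      = (∫ x, levyIntegrand (t • z) x ∂ν.posPart) - ∫ x, levyIntegrand (t • z) x ∂ν.negPart := rfl
  rw [levyKhintchineExponent, hI]
  simp only [real_inner_smul_right, WithLp.ofLp_smul, Matrix.mulVec_smul, smul_dotProduct,
    dotProduct_smul, smul_eq_mul, Complex.ofReal_mul, Complex.ofReal_inv]
  field_simp
  ring

end QID

theorem lemma2p4 {d : ℕ} (μ : MeasureTheory.Measure (QID.E d))
    (A : Matrix (Fin d) (Fin d) ℝ) (ν : QID.LocalSignedMeasure d) (γ : QID.E d)
    (hμ : QID.IsQuasiInfinitelyDivisible μ)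
    (htriplet : QID.HasCharacteristicTriplet μ A ν γ) :
    A.PosSemidef := by
  have := hμ.1
  -- Conjugation on `ℝ` is trivial, so symmetry serves as hermiticity.
  refine Matrix.PosSemidef.of_dotProduct_mulVec_nonneg htriplet.isSymm fun v => ?_
  have h := (Complex.continuous_re.tendsto _).comp
    (QID.tendsto_levyKhintchineExponent_div_sq A ν htriplet.isQuasiLevyType γ (WithLp.toLp 2 v))
  -- The sign holds for every real `t`, even `t = 0`, where the inverse is 0 by convention.
  have hle := le_of_tendsto h (b := 0) <| .of_forall fun t => by
    have h1 := norm_charFun_le_one (μ := μ) (t • WithLp.toLp 2 v)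
    -- `|exp w| = exp (Re w)`, so the bound by one says that the real part of the exponent is at
    -- most 0.
    rw [htriplet.charFun_eq, Complex.norm_exp, Real.exp_le_one_iff] at h1
    rw [Function.comp_apply, ← Complex.ofReal_pow, ← Complex.ofReal_inv, Complex.re_ofReal_mul]
    exact mul_nonpos_of_nonneg_of_nonpos (by positivity) h1
  have hre : (-(1 / 2 : ℂ) * ((v ⬝ᵥ A.mulVec v : ℝ) : ℂ)).re = -(1 / 2) * (v ⬝ᵥ A.mulVec v) := by
    rw [Complex.re_mul_ofReal]
    norm_num
  rw [hre] at hle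
  rw [star_trivial]
  linarith
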